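/- Let $T$ be a complete first-order theory in a language $L$ and let $M \models T$ be $\kappa$-saturated for some cardinal $\kappa > \aleph_0$ (for instance a monster model of $T$). Below, $x$ and $y$ are finite tuples of variables, and all parameters and tuples are from $M$ unless another model is named. Conventions. A family $\{\varphi(x,a_i)\}_{i\in I}$ is *consistent* if it is finitely satisfiable in the model, and *$k$-inconsistent* if no $k$ of its members (with distinct indices) are jointly satisfiable. A formula $\varphi(x,y)$ is $\mathrm{TP}_2$ if, in some model of $T$, there are $(a_{ij})_{i,j\in\omega}$ and $k\in\omega$ such that $\{\varphi(x,a_{ij})\}_{j\in\omega}$ is $k$-inconsistent for every $i\in\omega$ and $\{\varphi(x,a_{i f(i)})\}_{i\in\omega}$ is consistent for every $f:\omega\to\omega$; $T$ is $\mathrm{NTP}_2$ if no $L$-formula $\varphi(x,y)$ is $\mathrm{TP}_2$. An array $(a_{ij})_{i,j\in\omega}$ of tuples is *indiscernible over $A$* if the sequence of rows $((a_{ij})_{j\in\omega})_{i\in\omega}$ and the sequence of columns $((a_{ij})_{i\in\omega})_{j\in\omega}$ are both indiscernible over $A$; it is *indiscernible* if this holds for $A=\emptyset$. The formula $\varphi(x,a)$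 *divides over $A$* if for some $k\in\omega$ there is a sequence $(a_i)_{i\in\omega}$ with $a_i\equiv_A a$ for all $i$ such that $\{\varphi(x,a_i)\}_{i\in\omega}$ is $k$-inconsistent; it *array-divides over $A$* if there is an array $(a_{ij})_{i,j\in\omega}$ indiscernible over $A$ such that $a_{00}=a$ and $\{\varphi(x,a_{ij})\}_{i,j\in\omega}$ is inconsistent. Then: 1. $T$ is $\mathrm{NTP}_2$ if and only if, for every $L$-formula $\varphi(x,y)$ and every indiscernible array $(a_{ij})_{i,j\in\omega}$ in $M$ whose diagonal $\{\varphi(x,a_{ii})\}_{i\in\omega}$ is consistent, the whole array $\{\varphi(x,a_{ij})\}_{i,j\in\omega}$ is consistent. 2. If $T$ is $\mathrm{NTP}_2$, then for every $L$-formula $\varphi(x,y)$, every tuple $a$ in $M$ and every $A\subseteq M$ with $|A|<\kappa$, the formula $\varphi(x,a)$ divides over $A$ if and only if it array-divides over $A$. -/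

import Mathlib

open Cardinal FirstOrder

universe u v w

namespace NTP2

open FirstOrder.Language

section Structure

variable {L : FirstOrder.Language.{u, v}} {M : Type w} [L.Structure M]

/-- `v` and `v'` have the same complete type over `A`. A formula with parameters in `A` is given as
an `L`-formula some of whose free variables are evaluated at the elements of `A`. -/
def SameType (L : FirstOrder.Language.{u, v}) {M : Type w} [L.Structure M] (A : Set M)
    {β : Type*} (v v' : β → M) : Prop :=
  ∀ ψ : L.Formula (A ⊕ β),
    ψ.Realize (Sum.elim Subtype.val v) ↔ ψ.Realize (Sum.elim Subtype.val v')

/-- `κ`-saturation: every 1-type (a finitely satisfiable set of formulas in one variable) over a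
subset of cardinality less than `κ` is realized. -/
def IsSaturated (L : FirstOrder.Language.{u, v}) (M : Type w) [L.Structure M]
    (κ : Cardinal.{w}) : Prop :=
  ∀ A : Set M, #A < κ → ∀ p : Set (L.Formula (A ⊕ Unit)),
    (∀ q : Finset (L.Formula (A ⊕ Unit)), (q : Set (L.Formula (A ⊕ Unit))) ⊆ p →
      ∃ b : M, ∀ ψ ∈ q, ψ.Realize (Sum.elim Subtype.val fun _ => b)) →
    ∃ b : M, ∀ ψ ∈ p, ψ.Realize (Sum.elim Subtype.val fun _ => b)

/-- The set `{φ(x, a i) : i ∈ ι}` is consistent (with the elementary diagram of `M`), i.e. it is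
finitely satisfiable in `M`. -/
def IsConsistent {n m : ℕ} {ι : Type*} (φ : L.Formula (Fin n ⊕ Fin m))
    (a : ι → Fin m → M) : Prop :=
  ∀ s : Finset ι, ∃ b : Fin n → M, ∀ i ∈ s, φ.Realize (Sum.elim b (a i))

/-- The family `{φ(x, a i) : i ∈ ι}` is `k`-inconsistent: no `k` members of it are jointly
satisfiable. -/
def IsKInconsistent {n m : ℕ} {ι : Type*} (φ : L.Formula (Fin n ⊕ Fin m))
    (a : ι → Fin m → M) (k : ℕ) : Prop :=
  ∀ s : Finset ι, s.card = k → ¬ ∃ b : Fin n → M, ∀ i ∈ s, φ.Realize (Sum.elim b (a i))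

/-- The partitioned formula `φ(x, y)` has the tree property of the second kind, witnessed in `M`. -/
def HasTP2 (M : Type w) [L.Structure M] {n m : ℕ} (φ : L.Formula (Fin n ⊕ Fin m)) : Prop :=
  ∃ (a : ℕ → ℕ → Fin m → M) (k : ℕ),
    (∀ i, IsKInconsistent φ (fun j => a i j) k) ∧
    ∀ f : ℕ → ℕ, IsConsistent φ (fun i => a i (f i))

/-- A sequence of (possibly infinite) tuples is indiscernible over `A`. -/
def IsIndiscernible (L : FirstOrder.Language.{u, v}) {M : Type w} [L.Structure M] (A : Set M)
    {β : Type*} (a : ℕ → β → M) : Prop :=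
  ∀ (r : ℕ) (s t : Fin r → ℕ), StrictMono s → StrictMono t →
    SameType L A (fun p : Fin r × β => a (s p.1) p.2) (fun p : Fin r × β => a (t p.1) p.2)

/-- An array is indiscernible over `A` if both the sequence of its rows and the sequence of its
columns are indiscernible over `A`. -/
def IsIndiscernibleArray (L : FirstOrder.Language.{u, v}) {M : Type w} [L.Structure M] (A : Set M)
    {m : ℕ} (a : ℕ → ℕ → Fin m → M) : Prop :=
  IsIndiscernible L A (fun i (p : ℕ × Fin m) => a i p.1 p.2) ∧
  IsIndiscernible L A (fun j (p : ℕ × Fin m) => a p.1 j p.2)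

/-- `φ(x, a)` divides over `A`. -/
def Divides {n m : ℕ} (φ : L.Formula (Fin n ⊕ Fin m)) (a : Fin m → M) (A : Set M) : Prop :=
  ∃ (k : ℕ) (b : ℕ → Fin m → M), (∀ i, SameType L A (b i) a) ∧ IsKInconsistent φ b k

/-- `φ(x, a)` array-divides over `A`. -/
def ArrayDivides {n m : ℕ} (φ : L.Formula (Fin n ⊕ Fin m)) (a : Fin m → M) (A : Set M) : Prop :=
  ∃ b : ℕ → ℕ → Fin m → M, IsIndiscernibleArray L A b ∧ b 0 0 = a ∧
    ¬ IsConsistent φ (fun p : ℕ × ℕ => b p.1 p.2)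

end Structure

/-- `T` is `NTP₂`: no partitioned formula has `TP₂` in a model of `T`. -/
def IsNTP2 {L : FirstOrder.Language.{u, v}} (T : L.Theory) : Prop :=
  ∀ (N : FirstOrder.Language.Theory.ModelType.{u, v, w} T) (n m : ℕ)
    (φ : L.Formula (Fin n ⊕ Fin m)), ¬ HasTP2 N φ

end NTP2

namespace NTP2

open FirstOrder.Language Filter

/-! ### Existential projection, finite conjunctions, and transfer between models of a complete
theory. -/

section Formulas

variable {L : FirstOrder.Language.{u, v}}

/-! The heart of the matter is that, without `TP₂`, consistency spreads from the diagonal of an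
array to the whole array. Only one consequence of indiscernibility is needed: satisfiability of a
finite subfamily is unchanged by increasing reindexing of rows and columns (`GridInvariant`). This
survives transposition and passage to arrays of blocks, with `tupleFormula` in place of `φ`.

If the diagonal is consistent but row 0 is not, cut row `i` at column `i * R`, with `R` tending to
infinity. The rows stay uniformly inconsistent, while every path becomes an increasing sequence of
cells, consistent like the diagonal: this is `TP₂`. So a consistent diagonal yields a consistent row
(`GridInvariant.isConsistent_row`). Applied to blocks cut from the diagonal, this makes a staircase
of horizontal strips consistent; applied again, to columns of strips, it makes every initial square
consistent (`GridInvariant.isConsistent`).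

Conversely, an indiscernible array extracted from a `TP₂` array has a consistent diagonal and an
inconsistent row. Extraction uses limits along iterated tensor powers of a nonprincipal ultrafilter
instead of Ramsey's theorem; saturation realizes these limits in `M`. For dividing, an indiscernible
sequence gives an array with constant rows, and the diagonal of an array-dividing witness gives
dividing. -/

theorem realize_congr_freeVar {M : Type*} [L.Structure M] {α : Type*} [DecidableEq α]
    (φ : L.Formula α) {v v' : α → M}
    (h : ∀ a ∈ BoundedFormula.freeVarFinset φ, v a = v' a) : φ.Realize v ↔ φ.Realize v' := by
  have h1 := BoundedFormula.realize_restrictFreeVar (φ := φ) (f := id)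
    (v := fun a => v a) (xs := default) v (fun _ => rfl)
  have h2 := BoundedFormula.realize_restrictFreeVar (φ := φ) (f := id)
    (v := fun a => v a) (xs := default) v' (fun a => h a a.2)
  exact h1.symm.trans h2

open Classical in
/-- The formula `∃ γ, φ`, where `γ` may be infinite. -/
noncomputable def exProj {α γ : Type*} (φ : L.Formula (α ⊕ γ)) : L.Formula α :=
  Formula.iExs (BoundedFormula.freeVarFinset φ)
    (BoundedFormula.restrictFreeVar φ
      (fun x => match x with
        | ⟨Sum.inl a, _⟩ => Sum.inl a
        | ⟨Sum.inr g, h⟩ => Sum.inr ⟨Sum.inr g, h⟩))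

theorem realize_exProj {M : Type*} [L.Structure M] [Nonempty M] {α γ : Type*}
    (φ : L.Formula (α ⊕ γ)) (v : α → M) :
    (exProj φ).Realize v ↔ ∃ w : γ → M, φ.Realize (Sum.elim v w) := by
  classical
  unfold exProj
  rw [Formula.realize_iExs]
  constructor
  · rintro ⟨w, hw⟩
    refine ⟨fun g => if h : Sum.inr g ∈ BoundedFormula.freeVarFinset φ then w ⟨_, h⟩
      else Classical.arbitrary M, ?_⟩
    refine (BoundedFormula.realize_restrictFreeVar _ ?_).1 hw
    rintro ⟨a | g, h⟩
    · rfl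
    · simp [h]
  · rintro ⟨w, hw⟩
    refine ⟨fun x => Sum.elim v w x, ?_⟩
    refine (BoundedFormula.realize_restrictFreeVar _ ?_).2 hw
    rintro ⟨a | g, h⟩ <;> rfl

/-- The conjunction of a finite set of formulas. -/
noncomputable def conj {α : Type*} (q : Finset (L.Formula α)) : L.Formula α :=
  Formula.iInf (fun ψ : q => ψ.1)

theorem realize_conj {M : Type*} [L.Structure M] {α : Type*} (q : Finset (L.Formula α))
    (v : α → M) : (conj q).Realize v ↔ ∀ ψ ∈ q, ψ.Realize v := by
  simp [conj]

/-- The formula `∃ x, ⋀ i ∈ s, φ(x, e i)`. -/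
noncomputable def familyFormula {n : ℕ} {β ι γ : Type*} (φ : L.Formula (Fin n ⊕ β))
    (s : Finset ι) (e : ι → β → γ) : L.Formula γ :=
  exProj (Formula.iInf fun i : s => φ.relabel (Sum.elim Sum.inr fun y => Sum.inl (e i y)))

theorem realize_familyFormula {M : Type*} [L.Structure M] [Nonempty M] {n : ℕ} {β ι γ : Type*}
    (φ : L.Formula (Fin n ⊕ β)) (s : Finset ι) (e : ι → β → γ) (v : γ → M) :
    (familyFormula φ s e).Realize v ↔
      ∃ b : Fin n → M, ∀ i ∈ s, φ.Realize (Sum.elim b fun y => v (e i y)) := by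
  have key : ∀ (b : Fin n → M) (i : ι),
      (Sum.elim v b ∘ Sum.elim Sum.inr fun y => Sum.inl (e i y)) =
        Sum.elim b fun y => v (e i y) := by
    intro b i
    ext (x | y) <;> rfl
  simp [familyFormula, realize_exProj, Formula.realize_relabel, key]

theorem exists_realize_of_complete {T : L.Theory} (hT : T.IsComplete) {M N : Type*}
    [L.Structure M] [L.Structure N] [Nonempty M] [Nonempty N] (hM : M ⊨ T) (hN : N ⊨ T)
    {γ : Type*} (φ : L.Formula γ) (h : ∃ v : γ → N, φ.Realize v) : ∃ v : γ → M, φ.Realize v := by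
  classical
  obtain ⟨v, hv⟩ := h
  let θ : L.Sentence := exProj (φ.relabel Sum.inr)
  have h1 : N ⊨ θ := by
    refine (realize_exProj _ _).2 ⟨v, ?_⟩
    rw [Formula.realize_relabel]
    exact hv
  have h2 : M ⊨ θ := (hT.realize_sentence_iff θ M).2 ((hT.realize_sentence_iff θ N).1 h1)
  obtain ⟨w, hw⟩ := (realize_exProj _ _).1 h2
  rw [Formula.realize_relabel] at hw
  exact ⟨w, hw⟩

end Formulas

/-! ### From saturation for 1-types to countable types and ultralimits. -/

section Saturation

variable {L : FirstOrder.Language.{u, v}} {M : Type w} [L.Structure M] [Nonempty M]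
  {κ : Cardinal.{w}}

/-- `p` is finitely satisfiable by assignments that agree with `b` below `n`. -/
def FinSatWith {A : Set M} (p : Set (L.Formula (A ⊕ ℕ))) (n : ℕ) (b : ℕ → M) : Prop :=
  ∀ q : Finset (L.Formula (A ⊕ ℕ)), (q : Set (L.Formula (A ⊕ ℕ))) ⊆ p →
    ∃ v : ℕ → M, (∀ i < n, v i = b i) ∧ ∀ ψ ∈ q, ψ.Realize (Sum.elim Subtype.val v)

/-- The parameters fixed so far are finite in number, so adding them to `A` keeps the cardinality
below `κ`. The next value realizes the 1-type of all projections of finite parts of `p`. -/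
theorem FinSatWith.exists_update (hsat : IsSaturated L M κ) (hκ : ℵ₀ < κ) {A : Set M}
    (hA : #A < κ) {p : Set (L.Formula (A ⊕ ℕ))} {n : ℕ} {b : ℕ → M} (h : FinSatWith p n b) :
    ∃ e : M, FinSatWith p (n + 1) (Function.update b n e) := by
  classical
  let B : Set M := A ∪ b '' Set.Iio n
  have hB : #B < κ := by
    refine (mk_union_le _ _).trans_lt (add_lt_of_lt hκ.le hA ?_)
    exact (((Set.finite_Iio n).image b).lt_aleph0).trans hκ
  let g : A ⊕ ℕ → (B ⊕ Unit) ⊕ ℕ := Sum.elim (fun a => Sum.inl (Sum.inl ⟨a, Or.inl a.2⟩))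
    (fun i => if h : i < n then Sum.inl (Sum.inl ⟨b i, Or.inr ⟨i, h, rfl⟩⟩)
      else if i = n then Sum.inl (Sum.inr ()) else Sum.inr i)
  have hg : ∀ (e : M) (v : ℕ → M), Sum.elim (Sum.elim (Subtype.val : B → M) fun _ => e) v ∘ g =
      Sum.elim Subtype.val (fun i => if i < n then b i else if i = n then e else v i) := by
    intro e v
    ext (a | i)
    · rfl
    · simp only [Function.comp, g, Sum.elim_inr]
      split_ifs <;> rfl
  let θ : Finset (L.Formula (A ⊕ ℕ)) → L.Formula (B ⊕ Unit) :=
    fun q => exProj ((conj q).relabel g)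
  have hθ : ∀ q (e : M), (θ q).Realize (Sum.elim Subtype.val fun _ => e) ↔
      ∃ v : ℕ → M, ∀ ψ ∈ q, ψ.Realize
        (Sum.elim Subtype.val (fun i => if i < n then b i else if i = n then e else v i)) := by
    intro q e
    simp only [θ, realize_exProj, Formula.realize_relabel, hg, realize_conj]
  obtain ⟨e, he⟩ := hsat B hB {χ | ∃ q : Finset (L.Formula (A ⊕ ℕ)),
      (q : Set (L.Formula (A ⊕ ℕ))) ⊆ p ∧ χ = θ q} (by
    intro Q hQ
    choose! f hf using hQ
    obtain ⟨v, hv, hv'⟩ := h (Q.biUnion f) (by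
      intro ψ hψ
      simp only [Finset.coe_biUnion, Set.mem_iUnion] at hψ
      obtain ⟨χ, hχ, hψ⟩ := hψ
      exact (hf hχ).1 hψ)
    refine ⟨v n, fun χ hχ => ?_⟩
    rw [(hf hχ).2, hθ]
    refine ⟨v, fun ψ hψ => ?_⟩
    have : (fun i => if i < n then b i else if i = n then v n else v i) = v := by
      ext i
      split_ifs with h1 h2
      · exact (hv i h1).symm
      · rw [h2]
      · rfl
    rw [this]
    exact hv' ψ (Finset.mem_biUnion.2 ⟨χ, hχ, hψ⟩))
  refine ⟨e, fun q hq => ?_⟩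
  obtain ⟨v, hv⟩ := (hθ q e).1 (he _ ⟨q, hq, rfl⟩)
  refine ⟨_, fun i hi => ?_, hv⟩
  rcases Nat.lt_succ_iff_lt_or_eq.1 hi with h1 | rfl
  · simp [h1, h1.ne]
  · simp

theorem exists_realize_nat (hsat : IsSaturated L M κ) (hκ : ℵ₀ < κ) {A : Set M}
    (hA : #A < κ) {p : Set (L.Formula (A ⊕ ℕ))}
    (h : ∀ q : Finset (L.Formula (A ⊕ ℕ)), (q : Set (L.Formula (A ⊕ ℕ))) ⊆ p →
      ∃ v : ℕ → M, ∀ ψ ∈ q, ψ.Realize (Sum.elim Subtype.val v)) :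
    ∃ v : ℕ → M, ∀ ψ ∈ p, ψ.Realize (Sum.elim Subtype.val v) := by
  classical
  have h0 : FinSatWith p 0 (fun _ => Classical.arbitrary M) := fun q hq =>
    (h q hq).imp fun v hv => ⟨by simp, hv⟩
  have hs : ∀ n (b : {b : ℕ → M // FinSatWith p n b}), ∃ b' : {b : ℕ → M // FinSatWith p (n + 1) b},
      ∀ i < n, b'.1 i = b.1 i := by
    rintro n ⟨b, hb⟩
    obtain ⟨e, he⟩ := hb.exists_update hsat hκ hA
    exact ⟨⟨_, he⟩, fun i hi => by simp [hi.ne]⟩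
  choose f hf using hs
  let B : ∀ n, {b : ℕ → M // FinSatWith p n b} := fun n => Nat.rec ⟨_, h0⟩ f n
  have hB : ∀ n i, i < n → (B n).1 i = (B (i + 1)).1 i := by
    intro n i hi
    induction n, Nat.succ_le_of_lt hi using Nat.le_induction with
    | base => rfl
    | succ m hm ih => exact (hf m (B m) i (Nat.lt_of_succ_le hm)).trans (ih (Nat.lt_of_succ_le hm))
  -- Coordinate `i` is frozen from stage `i + 1` on, so a single formula sees only values already
  -- fixed at some stage `r`.
  refine ⟨fun i => (B (i + 1)).1 i, fun ψ hψ => ?_⟩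
  obtain ⟨r, hr⟩ : ∃ r, ∀ i : ℕ, Sum.inr i ∈ BoundedFormula.freeVarFinset ψ → i < r := by
    refine ⟨(BoundedFormula.freeVarFinset ψ).sup (Sum.elim (fun _ => 0) id) + 1, fun i hi => ?_⟩
    exact Nat.lt_succ_of_le (Finset.le_sup (f := Sum.elim (fun _ => 0) id) hi)
  obtain ⟨v, hv, hv'⟩ := (B r).2 {ψ} (by simpa using hψ)
  refine (realize_congr_freeVar ψ ?_).1 (hv' ψ (by simp))
  rintro (a | i) hi
  · rfl
  · exact (hv i (hr i hi)).trans (hB r i (hr i hi))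

theorem exists_realize_countable (hsat : IsSaturated L M κ) (hκ : ℵ₀ < κ) {A : Set M}
    (hA : #A < κ) {γ : Type*} [Countable γ] {p : Set (L.Formula (A ⊕ γ))}
    (h : ∀ q : Finset (L.Formula (A ⊕ γ)), (q : Set (L.Formula (A ⊕ γ))) ⊆ p →
      ∃ v : γ → M, ∀ ψ ∈ q, ψ.Realize (Sum.elim Subtype.val v)) :
    ∃ v : γ → M, ∀ ψ ∈ p, ψ.Realize (Sum.elim Subtype.val v) := by
  classical
  obtain ⟨e, he⟩ := exists_injective_nat γ
  have hcomp : ∀ v : ℕ → M, (Sum.elim (Subtype.val : A → M) v ∘ Sum.map id e) =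
      Sum.elim Subtype.val (v ∘ e) := by
    intro v
    ext (a | i) <;> rfl
  obtain ⟨v, hv⟩ := exists_realize_nat hsat hκ hA
    (p := (fun ψ : L.Formula (A ⊕ γ) => ψ.relabel (Sum.map id e)) '' p) (by
      intro q hq
      obtain ⟨q', hq', rfl⟩ := Finset.subset_set_image_iff.1 hq
      obtain ⟨v, hv⟩ := h q' hq'
      refine ⟨Function.extend e v fun _ => Classical.arbitrary M, ?_⟩
      simp only [Finset.mem_image, forall_exists_index, and_imp, forall_apply_eq_imp_iff₂]
      intro ψ hψ
      rw [Formula.realize_relabel, hcomp, Function.extend_comp he]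
      exact hv ψ hψ)
  refine ⟨v ∘ e, fun ψ hψ => ?_⟩
  have := hv _ (Set.mem_image_of_mem _ hψ)
  rwa [Formula.realize_relabel, hcomp] at this

/-- In a saturated structure every ultrafilter of countable tuples has a limit of the same type. -/
theorem exists_ultralimit (hsat : IsSaturated L M κ) (hκ : ℵ₀ < κ) {A : Set M}
    (hA : #A < κ) {γ ι : Type*} [Countable γ] (V : Ultrafilter ι) (c : ι → γ → M) :
    ∃ c' : γ → M, ∀ ψ : L.Formula (A ⊕ γ), ψ.Realize (Sum.elim Subtype.val c') ↔
      ∀ᶠ i in (V : Filter ι), ψ.Realize (Sum.elim Subtype.val (c i)) := by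
  obtain ⟨c', hc'⟩ := exists_realize_countable hsat hκ hA
    (p := {ψ | ∀ᶠ i in (V : Filter ι), ψ.Realize (Sum.elim Subtype.val (c i))}) (by
      intro q hq
      have : ∀ᶠ i in (V : Filter ι), ∀ ψ ∈ q, ψ.Realize (Sum.elim Subtype.val (c i)) :=
        (Filter.eventually_all_finset q).2 fun ψ hψ => hq hψ
      obtain ⟨i, hi⟩ := this.exists
      exact ⟨c i, hi⟩)
  refine ⟨c', fun ψ => ⟨fun h => ?_, fun h => hc' ψ h⟩⟩
  by_contra hn
  have h2 := hc' ψ.not (by simpa [Formula.realize_not] using Ultrafilter.eventually_not.2 hn)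
  exact (Formula.realize_not.1 h2) h

end Saturation

/-! ### Iterated ultrafilters on sequences of indices. -/

section Combinatorics

theorem exists_strictMono_extension (r : ℕ) (s : ℕ → ℕ) (hs : StrictMonoOn s (Set.Iio r)) :
    ∃ t : ℕ → ℕ, StrictMono t ∧ ∀ i < r, t i = s i := by
  cases r with
  | zero => exact ⟨id, strictMono_id, by simp⟩
  | succ r =>
    refine ⟨fun i => if i < r + 1 then s i else s r + i, strictMono_nat_of_lt_succ fun i => ?_, ?_⟩
    · rcases lt_trichotomy i r with h | rfl | h
      · have := hs (show i < r + 1 by omega) (show i + 1 < r + 1 by omega) (Nat.lt_succ_self i)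
        simp [show i < r + 1 by omega, show i + 1 < r + 1 by omega, this]
      · simp
      · simp [show ¬ i < r + 1 by omega, show ¬ i + 1 < r + 1 by omega]
    · intro i hi
      simp [hi]

theorem exists_strictMono_extension_fin {r : ℕ} (s : Fin r → ℕ) (hs : StrictMono s) :
    ∃ t : ℕ → ℕ, StrictMono t ∧ ∀ i : Fin r, t i = s i := by
  obtain ⟨t, ht, h⟩ := exists_strictMono_extension r (fun i => if h : i < r then s ⟨i, h⟩ else 0)
    (fun i hi j hj hij => by
      simp only [Set.mem_Iio] at hi hj
      simpa [hi, hj] using hs (show (⟨i, hi⟩ : Fin r) < ⟨j, hj⟩ from hij))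
  exact ⟨t, ht, fun i => by simpa using h i i.2⟩

/-- `P` depends only on the first `r` terms of a sequence. -/
def DependsOnInit (r : ℕ) (P : (ℕ → ℕ) → Prop) : Prop :=
  ∀ s s' : ℕ → ℕ, (∀ i < r, s i = s' i) → (P s ↔ P s')

/-- The `r`-fold tensor power of a nonprincipal ultrafilter on `ℕ`. -/
noncomputable def tensorPower : ℕ → Ultrafilter (ℕ → ℕ)
  | 0 => pure id
  | r + 1 => (tensorPower r).bind fun s => (hyperfilter ℕ).map fun i => Function.update s r i

theorem eventually_tensorPower_succ (r : ℕ) (P : (ℕ → ℕ) → Prop) :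
    (∀ᶠ s in (tensorPower (r + 1) : Filter (ℕ → ℕ)), P s) ↔
      ∀ᶠ s in (tensorPower r : Filter (ℕ → ℕ)), ∀ᶠ i in (hyperfilter ℕ : Filter ℕ),
        P (Function.update s r i) :=
  Iff.rfl

theorem eventually_strictMonoOn_tensorPower (r : ℕ) :
    ∀ᶠ s in (tensorPower r : Filter (ℕ → ℕ)), StrictMonoOn s (Set.Iio r) := by
  induction r with
  | zero => exact Eventually.of_forall fun s i hi => by simp at hi
  | succ r ih =>
    rw [eventually_tensorPower_succ]
    filter_upwards [ih] with s hs
    have : ∀ᶠ i in (hyperfilter ℕ : Filter ℕ), ∀ j ∈ Finset.range r, s j < i :=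
      Nat.hyperfilter_le_atTop
        ((Filter.eventually_all_finset _).2 fun j _ => eventually_gt_atTop (s j))
    filter_upwards [this] with i hi a ha b hb hab
    simp only [Set.mem_Iio] at ha hb
    rcases Nat.lt_succ_iff_lt_or_eq.1 hb with hb' | rfl
    · rw [Function.update_of_ne (by omega), Function.update_of_ne (by omega)]
      exact hs (hab.trans hb') hb' hab
    · rw [Function.update_of_ne (by omega), Function.update_self]
      exact hi a (by simpa using hab)

/-- A coordinate that `P` does not see can be dropped, since a constant property holds eventually
exactly when it holds. Peeling off the last factor, it is either invisible to `P (s ∘ u)` or is the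
last coordinate read. -/
theorem eventually_tensorPower_comp (u : ℕ → ℕ) (hu : StrictMono u) (R : ℕ) :
    ∀ (r : ℕ) (P : (ℕ → ℕ) → Prop), DependsOnInit r P → (∀ i < r, u i < R) →
      ((∀ᶠ s in (tensorPower R : Filter (ℕ → ℕ)), P (s ∘ u)) ↔
        ∀ᶠ s in (tensorPower r : Filter (ℕ → ℕ)), P s) := by
  have hconst : ∀ (P : (ℕ → ℕ) → Prop), DependsOnInit 0 P → ∀ R : ℕ,
      ((∀ᶠ s in (tensorPower R : Filter (ℕ → ℕ)), P (s ∘ u)) ↔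
        ∀ᶠ s in (tensorPower 0 : Filter (ℕ → ℕ)), P s) := by
    intro P hP R
    have h : ∀ s, P s ↔ P id := fun s => hP _ _ (by simp)
    simp [h]
  induction R with
  | zero =>
    intro r P hP hr
    obtain rfl : r = 0 := by
      by_contra h
      exact absurd (hr 0 (by omega)) (by simp)
    exact hconst P hP 0
  | succ R ih =>
    intro r P hP hr
    cases r with
    | zero => exact hconst P hP _
    | succ r =>
      rw [eventually_tensorPower_succ]
      rcases Nat.lt_succ_iff_lt_or_eq.1 (hr r (by omega)) with h | h
      · rw [← ih (r + 1) P hP fun i hi => (hu.monotone (by omega : i ≤ r)).trans_lt h]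
        refine eventually_congr (Eventually.of_forall fun s => ?_)
        have : ∀ i, P (Function.update s R i ∘ u) ↔ P (s ∘ u) := fun i => hP _ _ fun j hj => by
          have := (hu.monotone (by omega : j ≤ r)).trans_lt h
          simp [this.ne]
        simp [this]
      · rw [eventually_tensorPower_succ, ← ih r _ (fun s s' hs => ?_) fun i hi => h ▸ hu hi]
        · refine eventually_congr (Eventually.of_forall fun s => ?_)
          refine eventually_congr (Eventually.of_forall fun i => hP _ _ fun j hj => ?_)
          rcases Nat.lt_succ_iff_lt_or_eq.1 hj with hj' | rfl
          · simp [hj'.ne, (h ▸ hu hj' : u j < R).ne]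
          · simp [h]
        · refine eventually_congr (Eventually.of_forall fun i => hP _ _ fun j hj => ?_)
          rcases Nat.lt_succ_iff_lt_or_eq.1 hj with hj' | rfl
          · simp [hj'.ne, hs j hj']
          · simp

/-- The limit of the tensor powers of a nonprincipal ultrafilter on `ℕ`. -/
noncomputable def tensorLimit : Ultrafilter (ℕ → ℕ) :=
  (hyperfilter ℕ).bind tensorPower

theorem eventually_tensorLimit (P : (ℕ → ℕ) → Prop) :
    (∀ᶠ s in (tensorLimit : Filter (ℕ → ℕ)), P s) ↔
      ∀ᶠ R in (hyperfilter ℕ : Filter ℕ), ∀ᶠ s in (tensorPower R : Filter (ℕ → ℕ)), P s :=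
  Iff.rfl

theorem eventually_strictMonoOn_tensorLimit (r : ℕ) :
    ∀ᶠ s in (tensorLimit : Filter (ℕ → ℕ)), StrictMonoOn s (Set.Iio r) := by
  rw [eventually_tensorLimit]
  filter_upwards [Nat.hyperfilter_le_atTop (eventually_ge_atTop r)] with R hR
  filter_upwards [eventually_strictMonoOn_tensorPower R] with s hs
  exact hs.mono fun i hi => lt_of_lt_of_le hi hR

/-- Once `R` passes `u r`, the powers agree on `P (s ∘ u)`, so the limit over `R` is that common
value and does not depend on `u`. This independence is the source of indiscernibility. -/
theorem eventually_tensorLimit_iff {r : ℕ} {P : (ℕ → ℕ) → Prop} (hP : DependsOnInit r P)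
    {u : ℕ → ℕ} (hu : StrictMono u) :
    (∀ᶠ s in (tensorLimit : Filter (ℕ → ℕ)), P (s ∘ u)) ↔
      ∀ᶠ s in (tensorPower r : Filter (ℕ → ℕ)), P s := by
  rw [eventually_tensorLimit, ← @eventually_const _ (hyperfilter ℕ : Filter ℕ) _
    (∀ᶠ s in (tensorPower r : Filter (ℕ → ℕ)), P s)]
  refine eventually_congr ?_
  filter_upwards [Nat.hyperfilter_le_atTop (eventually_ge_atTop (u r))] with R hR
  exact eventually_tensorPower_comp u hu R r P hP fun i hi => (hu hi).trans_le hR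

theorem eventually_tensorLimit_comp {r : ℕ} {P : (ℕ → ℕ) → Prop} (hP : DependsOnInit r P)
    {u : ℕ → ℕ} (hu : StrictMono u) :
    (∀ᶠ s in (tensorLimit : Filter (ℕ → ℕ)), P (s ∘ u)) ↔
      ∀ᶠ s in (tensorLimit : Filter (ℕ → ℕ)), P s :=
  (eventually_tensorLimit_iff hP hu).trans (eventually_tensorLimit_iff hP strictMono_id).symm

end Combinatorics

/-! ### Indiscernible sequences and their extraction. -/

section Indiscernible

variable {L : FirstOrder.Language.{u, v}} {M : Type w} [L.Structure M]

theorem SameType.comp {A : Set M} {β γ : Type*} {v v' : β → M} (h : SameType L A v v')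
    (g : γ → β) : SameType L A (v ∘ g) (v' ∘ g) := by
  intro ψ
  have hcomp : ∀ v : β → M, Sum.elim (Subtype.val : A → M) v ∘ Sum.map id g =
      Sum.elim Subtype.val (v ∘ g) := fun v => by ext (a | i) <;> rfl
  simpa [Formula.realize_relabel, hcomp] using h (ψ.relabel (Sum.map id g))

theorem SameType.symm {A : Set M} {β : Type*} {v v' : β → M} (h : SameType L A v v') :
    SameType L A v' v := fun ψ => (h ψ).symm

theorem SameType.trans {A : Set M} {β : Type*} {v v' v'' : β → M} (h : SameType L A v v')
    (h' : SameType L A v' v'') : SameType L A v v'' := fun ψ => (h ψ).trans (h' ψ)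

theorem SameType.realize_iff {A : Set M} {β : Type*} {v v' : β → M} (h : SameType L A v v')
    (ψ : L.Formula β) : ψ.Realize v ↔ ψ.Realize v' := by
  have := h (ψ.relabel Sum.inr)
  rwa [Formula.realize_relabel, Formula.realize_relabel] at this

theorem exists_init_bound {α β : Type*} (ψ : L.Formula (α ⊕ (ℕ × β))) :
    ∃ r, ∀ (f : α → M) (v v' : ℕ × β → M), (∀ i < r, ∀ p, v (i, p) = v' (i, p)) →
      (ψ.Realize (Sum.elim f v) ↔ ψ.Realize (Sum.elim f v')) := by
  classical
  refine ⟨(BoundedFormula.freeVarFinset ψ).sup (Sum.elim (fun _ => 0) Prod.fst) + 1,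
    fun f v v' h => realize_congr_freeVar ψ ?_⟩
  rintro (a | ⟨i, p⟩) hi
  · rfl
  · exact h i (Nat.lt_succ_of_le
      (Finset.le_sup (f := Sum.elim (fun _ => 0) Prod.fst) hi)) p

theorem isIndiscernible_iff {A : Set M} {β : Type*} {a : ℕ → β → M} :
    IsIndiscernible L A a ↔ ∀ s : ℕ → ℕ, StrictMono s →
      SameType L A (fun p : ℕ × β => a p.1 p.2) (fun p : ℕ × β => a (s p.1) p.2) := by
  constructor
  · intro h s hs ψ
    obtain ⟨r, hr⟩ := exists_init_bound (M := M) ψ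
    -- Reduction modulo `r + 1` is the identity on the indices below `r`, the only ones `ψ` sees;
    -- the extra 1 keeps `Fin (r + 1)` inhabited.
    have h1 := (h (r + 1) (fun i => i) (fun i => s i) (fun i j hij => hij)
      (fun i j hij => hs hij)).comp (fun p : ℕ × β => (Fin.ofNat (r + 1) p.1, p.2)) ψ
    have hi : ∀ i < r, i % (r + 1) = i := fun i hi => Nat.mod_eq_of_lt (by omega)
    refine ((hr _ _ _ ?_).trans h1).trans (hr _ _ _ ?_)
    · intro i hir p
      simp [hi i hir]
    · intro i hir p
      simp [hi i hir]
  · intro h r s t hs ht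
    obtain ⟨s', hs', hss⟩ := exists_strictMono_extension_fin s hs
    obtain ⟨t', ht', htt⟩ := exists_strictMono_extension_fin t ht
    have := ((h s' hs').symm.trans (h t' ht')).comp (fun p : Fin r × β => ((p.1 : ℕ), p.2))
    simpa [Function.comp_def, hss, htt] using this

theorem IsIndiscernible.sameType {A : Set M} {β : Type*} {a : ℕ → β → M}
    (h : IsIndiscernible L A a) {s t : ℕ → ℕ} (hs : StrictMono s) (ht : StrictMono t) :
    SameType L A (fun p : ℕ × β => a (s p.1) p.2) (fun p : ℕ × β => a (t p.1) p.2) :=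
  (isIndiscernible_iff.1 h s hs).symm.trans (isIndiscernible_iff.1 h t ht)

variable [Nonempty M] {κ : Cardinal.{w}}

/-- Every sequence has an indiscernible sequence over `A` that satisfies each formula over `A`
true of all its increasing subsequences. -/
theorem exists_isIndiscernible (hsat : IsSaturated L M κ) (hκ : ℵ₀ < κ) {A : Set M}
    (hA : #A < κ) {β : Type*} [Countable β] (c : ℕ → β → M) :
    ∃ c' : ℕ → β → M, IsIndiscernible L A c' ∧ ∀ ψ : L.Formula (A ⊕ (ℕ × β)),
      (∀ s : ℕ → ℕ, StrictMono s →
        ψ.Realize (Sum.elim Subtype.val fun p : ℕ × β => c (s p.1) p.2)) →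
      ∀ s : ℕ → ℕ, StrictMono s →
        ψ.Realize (Sum.elim Subtype.val fun p : ℕ × β => c' (s p.1) p.2) := by
  obtain ⟨d, hd⟩ := exists_ultralimit hsat hκ hA tensorLimit
    (fun s (p : ℕ × β) => c (s p.1) p.2)
  have hind : IsIndiscernible L A (fun i p => d (i, p)) := by
    rw [isIndiscernible_iff]
    intro s hs ψ
    obtain ⟨r, hr⟩ := exists_init_bound (M := M) ψ
    have hcomp : ∀ v : ℕ × β → M, Sum.elim (Subtype.val : A → M) v ∘
        Sum.map id (Prod.map s id) = Sum.elim Subtype.val (fun p => v (s p.1, p.2)) :=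
      fun v => by ext (a | i) <;> rfl
    have h1 := hd (ψ.relabel (Sum.map id (Prod.map s id)))
    simp only [Formula.realize_relabel, hcomp] at h1
    refine (hd ψ).trans (Iff.trans ?_ h1.symm)
    refine (eventually_tensorLimit_comp (r := r)
      (P := fun u => ψ.Realize (Sum.elim Subtype.val fun p : ℕ × β => c (u p.1) p.2)) ?_ hs).symm
    intro u u' huu
    exact hr _ _ _ fun i hi p => by simp [huu i hi]
  refine ⟨_, hind, fun ψ hψ s hs => ?_⟩
  rw [← isIndiscernible_iff.1 hind s hs ψ]
  refine (hd ψ).2 ?_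
  obtain ⟨r, hr⟩ := exists_init_bound (M := M) ψ
  filter_upwards [eventually_strictMonoOn_tensorLimit r] with u hu
  obtain ⟨t, ht, htu⟩ := exists_strictMono_extension r u hu
  exact (hr _ _ _ fun i hi p => by simp [htu i hi]).1 (hψ t ht)

end Indiscernible

/-! ### From a consistent diagonal to a consistent array. -/

section Arrays

variable {L : FirstOrder.Language.{u, v}} {M : Type w} [L.Structure M]

theorem exists_strictMono_image (T : Finset ℕ) :
    ∃ t : ℕ → ℕ, StrictMono t ∧ (Finset.range T.card).image t = T := by
  obtain ⟨t, ht, h⟩ := exists_strictMono_extension_fin (T.orderEmbOfFin rfl)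
    (T.orderEmbOfFin rfl).strictMono
  refine ⟨t, ht, Finset.eq_of_subset_of_card_le ?_ ?_⟩
  · intro x hx
    obtain ⟨i, hi, rfl⟩ := Finset.mem_image.1 hx
    rw [show t i = _ from h ⟨i, Finset.mem_range.1 hi⟩]
    exact Finset.orderEmbOfFin_mem _ _ _
  · rw [Finset.card_image_of_injective _ ht.injective, Finset.card_range]

theorem IsIndiscernibleArray.sameType {A : Set M} {m : ℕ} {a : ℕ → ℕ → Fin m → M}
    (h : IsIndiscernibleArray L A a) {s t : ℕ → ℕ} (hs : StrictMono s) (ht : StrictMono t) :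
    SameType L A (fun p : ℕ × ℕ × Fin m => a p.1 p.2.1 p.2.2)
      (fun p : ℕ × ℕ × Fin m => a (s p.1) (t p.2.1) p.2.2) :=
  SameType.trans (isIndiscernible_iff.1 h.1 s hs)
    ((isIndiscernible_iff.1 h.2 t ht).comp
      fun p : ℕ × ℕ × Fin m => (p.2.1, s p.1, p.2.2))

/-- Joint satisfiability of the finite subfamilies of `{φ(x, a i j)}` is invariant under strictly
increasing changes of the row and column indices. -/
def GridInvariant {n m : ℕ} (φ : L.Formula (Fin n ⊕ Fin m)) (a : ℕ → ℕ → Fin m → M) : Prop :=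
  ∀ (s t : ℕ → ℕ), StrictMono s → StrictMono t → ∀ S : Finset (ℕ × ℕ),
    (∃ b : Fin n → M, ∀ p ∈ S, φ.Realize (Sum.elim b (a p.1 p.2))) ↔
      ∃ b : Fin n → M, ∀ p ∈ S, φ.Realize (Sum.elim b (a (s p.1) (t p.2)))

theorem IsIndiscernibleArray.gridInvariant [Nonempty M] {A : Set M} {n m : ℕ}
    {a : ℕ → ℕ → Fin m → M} (h : IsIndiscernibleArray L A a) (φ : L.Formula (Fin n ⊕ Fin m)) :
    GridInvariant φ a := by
  intro s t hs ht S
  have := (h.sameType hs ht).realize_iff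
    (familyFormula φ S fun p l => ((p.1, p.2, l) : ℕ × ℕ × Fin m))
  rwa [realize_familyFormula, realize_familyFormula] at this

theorem GridInvariant.transpose {n m : ℕ} {φ : L.Formula (Fin n ⊕ Fin m)}
    {a : ℕ → ℕ → Fin m → M} (h : GridInvariant φ a) : GridInvariant φ (fun i j => a j i) := by
  intro s t hs ht S
  simpa only [Finset.forall_mem_image, Prod.fst_swap, Prod.snd_swap] using
    h t s ht hs (S.image Prod.swap)

theorem GridInvariant.row_iff {n m : ℕ} {φ : L.Formula (Fin n ⊕ Fin m)}
    {a : ℕ → ℕ → Fin m → M} (h : GridInvariant φ a) (i c : ℕ) (T : Finset ℕ) :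
    (∃ b : Fin n → M, ∀ j ∈ T, φ.Realize (Sum.elim b (a i (c + j)))) ↔
      ∃ b : Fin n → M, ∀ j < T.card, φ.Realize (Sum.elim b (a 0 j)) := by
  obtain ⟨t, ht, hT⟩ := exists_strictMono_image T
  have := h (fun x => x + i) (fun x => c + t x) (fun x y hxy => by simpa using hxy)
    (fun x y hxy => by simpa using ht hxy) ((Finset.range T.card).image fun j => (0, j))
  rw [← hT]
  simpa [Finset.card_image_of_injective _ ht.injective] using this.symm

/-- The conjunction of `k` instances of `φ`. -/
noncomputable def tupleFormula {n m : ℕ} (φ : L.Formula (Fin n ⊕ Fin m)) (k : ℕ) :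
    L.Formula (Fin n ⊕ Fin (k * m)) :=
  Formula.iInf fun l : Fin k => φ.relabel (Sum.map id fun y => finProdFinEquiv (l, y))

/-- The concatenation of `k` tuples. -/
def concat {k m : ℕ} (c : Fin k → Fin m → M) (z : Fin (k * m)) : M :=
  c (finProdFinEquiv.symm z).1 (finProdFinEquiv.symm z).2

theorem realize_tupleFormula {n m k : ℕ} (φ : L.Formula (Fin n ⊕ Fin m)) (b : Fin n → M)
    (c : Fin k → Fin m → M) :
    (tupleFormula φ k).Realize (Sum.elim b (concat c)) ↔
      ∀ l, φ.Realize (Sum.elim b (c l)) := by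
  have hcomp : ∀ l, (Sum.elim b (concat c) ∘ Sum.map id fun y => finProdFinEquiv (l, y)) =
      Sum.elim b (c l) := by
    intro l
    ext (x | y)
    · rfl
    · simp [concat]
  simp only [tupleFormula, Formula.realize_iInf, Formula.realize_relabel, hcomp]

/-- The hypotheses on `g₁` and `g₂` say that reindexing blocks is induced by a reindexing of cells,
so invariance of the cell array carries over to the block array. -/
theorem GridInvariant.tuple {n m k : ℕ} {φ : L.Formula (Fin n ⊕ Fin m)}
    {a : ℕ → ℕ → Fin m → M} (h : GridInvariant φ a) (g₁ g₂ : ℕ → Fin k → ℕ)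
    (h₁ : ∀ s : ℕ → ℕ, StrictMono s → ∃ s', StrictMono s' ∧ ∀ i l, g₁ (s i) l = s' (g₁ i l))
    (h₂ : ∀ s : ℕ → ℕ, StrictMono s → ∃ s', StrictMono s' ∧ ∀ i l, g₂ (s i) l = s' (g₂ i l)) :
    GridInvariant (tupleFormula φ k)
      (fun i j => concat fun l => a (g₁ i l) (g₂ j l)) := by
  intro s t hs ht S
  obtain ⟨s', hs', hs₁⟩ := h₁ s hs
  obtain ⟨t', ht', ht₁⟩ := h₂ t ht
  have := h s' t' hs' ht'
    ((S ×ˢ (Finset.univ : Finset (Fin k))).image fun q => (g₁ q.1.1 q.2, g₂ q.1.2 q.2))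
  simp only [realize_tupleFormula, hs₁, ht₁]
  simp only [Finset.forall_mem_image, Finset.mem_product, Finset.mem_univ, and_true] at this
  refine Iff.trans ?_ (this.trans ?_)
  · exact exists_congr fun b => ⟨fun H q hq => H q.1 hq q.2, fun H p hp l => H (x := (p, l)) hp⟩
  · exact exists_congr fun b => ⟨fun H p hp l => H (x := (p, l)) hp, fun H q hq => H q.1 hq q.2⟩

theorem strictMono_block {k : ℕ} {s : ℕ → ℕ} (hs : StrictMono s) :
    ∃ s' : ℕ → ℕ, StrictMono s' ∧ ∀ i (l : Fin k), k * s i + l = s' (k * i + l) := by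
  rcases Nat.eq_zero_or_pos k with rfl | hk
  · exact ⟨id, strictMono_id, fun i l => l.elim0⟩
  -- Move the block by `s` and keep the offset inside it.
  refine ⟨fun x => k * s (x / k) + x % k, fun x y hxy => ?_, fun i l => ?_⟩
  · have h1 := Nat.div_add_mod x k
    have h2 := Nat.div_add_mod y k
    have h3 := Nat.mod_lt x hk
    rcases (Nat.div_le_div_right (c := k) hxy.le).lt_or_eq with h | h
    · have : k * (s (x / k) + 1) ≤ k * s (y / k) := Nat.mul_le_mul_left k (hs h)
      simp only [Nat.mul_add, mul_one] at this ⊢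
      omega
    · simp only [h] at h1 ⊢
      omega
  · simp [Nat.mul_add_div hk, Nat.mod_eq_of_lt l.2, Nat.div_eq_of_lt l.2]

variable {κ : Cardinal.{w}}

theorem mk_empty_lt (hκ : ℵ₀ < κ) : #(∅ : Set M) < κ := by
  rw [mk_eq_zero]
  exact aleph0_pos.trans hκ

variable [Nonempty M]

/-- Otherwise `TP₂` arises from the limit of the arrays with entry `a i (i * R + j)` as `R` grows.
By invariance, a finite inconsistent part of row 0 makes all subfamilies of its size inconsistent in
every row. -/
theorem GridInvariant.isConsistent_row (hsat : IsSaturated L M κ) (hκ : ℵ₀ < κ) {n m : ℕ}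
    {φ : L.Formula (Fin n ⊕ Fin m)} {a : ℕ → ℕ → Fin m → M} (h : GridInvariant φ a)
    (hφ : ¬ HasTP2 M φ) (hdiag : IsConsistent φ fun i => a i i) :
    IsConsistent φ fun j => a 0 j := by
  by_contra hrow
  obtain ⟨T₀, hT₀⟩ : ∃ T₀ : Finset ℕ,
      ¬ ∃ b : Fin n → M, ∀ j ∈ T₀, φ.Realize (Sum.elim b (a 0 j)) := by
    simpa only [IsConsistent, not_forall] using hrow
  have hrow0 := mt (h.row_iff 0 0 T₀).2 (by simpa using hT₀)
  obtain ⟨d, hd⟩ := exists_ultralimit (L := L) hsat hκ (mk_empty_lt hκ) (hyperfilter ℕ)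
    (fun R (p : ℕ × ℕ × Fin m) => a p.1 (p.1 * R + p.2.1) p.2.2)
  have key : ∀ (I : Finset ℕ) (g₁ g₂ : ℕ → ℕ),
      (∃ b : Fin n → M, ∀ i ∈ I, φ.Realize (Sum.elim b fun l => d (g₁ i, g₂ i, l))) ↔
      ∀ᶠ R in (hyperfilter ℕ : Filter ℕ), ∃ b : Fin n → M, ∀ i ∈ I,
        φ.Realize (Sum.elim b (a (g₁ i) (g₁ i * R + g₂ i))) := by
    intro I g₁ g₂
    have := hd (familyFormula φ I fun i l => Sum.inr (g₁ i, g₂ i, l))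
    simpa only [realize_familyFormula, Sum.elim_inr] using this
  refine hφ ⟨fun i j l => d (i, j, l), T₀.card, fun i T hT hb => hrow0 ?_, fun f F => ?_⟩
  · obtain ⟨R, hR⟩ := ((key T (fun _ => i) id).1 hb).exists
    rw [← hT]
    exact (h.row_iff _ _ _).1 hR
  · refine (key F id f).2 ?_
    -- When `R` exceeds the values of `f` involved, `i * R + f i` is strictly increasing in `i`, so
    -- the path is a reindexed diagonal.
    have hlarge : ∀ᶠ R in (hyperfilter ℕ : Filter ℕ), ∀ i ∈ Finset.range (F.sup id + 1), f i < R :=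
      Nat.hyperfilter_le_atTop
        ((Filter.eventually_all_finset _).2 fun j _ => eventually_gt_atTop (f j))
    filter_upwards [hlarge] with R hR
    obtain ⟨t, ht, hti⟩ := exists_strictMono_extension (F.sup id + 1) (fun i => i * R + f i)
      (fun i hi j hj hij => by
        have h1 := hR i (Finset.mem_range.2 hi)
        have h2 : (i + 1) * R ≤ j * R := Nat.mul_le_mul_right R hij
        simp only [Nat.add_mul, one_mul] at h2 ⊢
        omega)
    obtain ⟨b, hb⟩ := (h id t strictMono_id ht (F.image fun i => (i, i))).1 (by
      simpa using hdiag F)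
    refine ⟨b, fun i hi => ?_⟩
    have := hb (i, i) (Finset.mem_image_of_mem _ hi)
    rwa [hti i (Nat.lt_succ_of_le (Finset.le_sup (f := id) hi))] at this


/-- Group the diagonals of the `k × k` blocks into tuples. The block diagonal is part of the
original diagonal, so the first row of blocks is consistent: it has `a l (k * j + l)` for all `l <
k` and all `j`. This row contains an increasing copy of the staircase. -/
theorem GridInvariant.isConsistent_diag_horizontal (hsat : IsSaturated L M κ) (hκ : ℵ₀ < κ)
    {n m : ℕ} {φ : L.Formula (Fin n ⊕ Fin m)} {a : ℕ → ℕ → Fin m → M} (h : GridInvariant φ a)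
    (hNTP : ∀ (m : ℕ) (φ : L.Formula (Fin n ⊕ Fin m)), ¬ HasTP2 M φ)
    (hdiag : IsConsistent φ fun i => a i i) (N : ℕ) :
    IsConsistent (tupleFormula φ N) fun i => concat fun l : Fin N => a i (N * i + l) := by
  intro F
  obtain ⟨k, hk0, hk⟩ : ∃ k, 0 < k ∧ ∀ i ∈ F, i < k :=
    ⟨F.sup id + 1, Nat.succ_pos _, fun i hi => Nat.lt_succ_of_le (Finset.le_sup (f := id) hi)⟩
  have hblock := (h.tuple (k := k) (fun i l => k * i + l) (fun i l => k * i + l)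
    (fun s hs => strictMono_block hs) (fun s hs => strictMono_block hs)).isConsistent_row
    hsat hκ (hNTP _ _) (by
      intro G
      obtain ⟨b, hb⟩ := hdiag ((G ×ˢ (Finset.univ : Finset (Fin k))).image
        fun q => k * q.1 + (q.2 : ℕ))
      refine ⟨b, fun i hi => (realize_tupleFormula _ _ _).2 fun l => hb _ ?_⟩
      exact Finset.mem_image.2 ⟨(i, l), by simpa using hi, rfl⟩)
  obtain ⟨b, hb⟩ := hblock (Finset.range (N * k))
  simp only [realize_tupleFormula, Finset.mem_range, mul_zero, zero_add] at hb
  -- Sends column `N * i + l` to `k * (N * i + l) + i`, which is where row `i` meets the diagonal of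
  -- block `N * i + l`.
  have hmono : StrictMono fun c => k * c + c / N := fun x y hxy =>
    add_lt_add_of_lt_of_le (Nat.mul_lt_mul_of_pos_left hxy hk0) (Nat.div_le_div_right hxy.le)
  obtain ⟨b', hb'⟩ := (h id _ strictMono_id hmono
    ((F ×ˢ (Finset.univ : Finset (Fin N))).image fun q => (q.1, N * q.1 + (q.2 : ℕ)))).2 ⟨b, by
      rw [Finset.forall_mem_image]
      rintro ⟨i, l⟩ hil
      have hi : i < k := hk i (Finset.mem_product.1 hil).1
      have hN : 0 < N := l.pos
      have hdiv : (N * i + l) / N = i := by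
        simp [Nat.mul_add_div hN, Nat.div_eq_of_lt l.2]
      have hlt : N * i + l < N * k := by
        have := Nat.mul_le_mul_left N (Nat.succ_le_of_lt hi)
        rw [Nat.mul_succ] at this
        have := l.2
        omega
      simpa only [hdiv, id] using hb _ hlt ⟨i, hi⟩⟩
  refine ⟨b', fun i hi => (realize_tupleFormula _ _ _).2 fun l => hb' (i, N * i + l) ?_⟩
  exact Finset.mem_image.2 ⟨(i, l), by simpa using hi, rfl⟩

/-- Under `NTP₂` the whole array is consistent as soon as its diagonal is. -/
theorem GridInvariant.isConsistent (hsat : IsSaturated L M κ) (hκ : ℵ₀ < κ)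
    {n m : ℕ} {φ : L.Formula (Fin n ⊕ Fin m)} {a : ℕ → ℕ → Fin m → M} (h : GridInvariant φ a)
    (hNTP : ∀ (m : ℕ) (φ : L.Formula (Fin n ⊕ Fin m)), ¬ HasTP2 M φ)
    (hdiag : IsConsistent φ fun i => a i i) :
    IsConsistent φ fun p : ℕ × ℕ => a p.1 p.2 := by
  intro S
  obtain ⟨N, hN⟩ : ∃ N, ∀ p ∈ S, p.1 < N ∧ p.2 < N := by
    refine ⟨S.sup (fun p => p.1 + p.2) + 1, fun p hp => ?_⟩
    have := Finset.le_sup (f := fun p : ℕ × ℕ => p.1 + p.2) hp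
    omega
  -- Cut each row into strips of length `N`. The staircase is the diagonal of the strip array, whose
  -- first column covers the initial `N × N` square.
  have hcol := ((h.tuple (k := N) (fun i _ => i) (fun j l => N * j + l)
    (fun s hs => ⟨s, hs, fun _ _ => rfl⟩) fun s hs => strictMono_block hs).transpose).isConsistent_row
    hsat hκ (hNTP _ _) (h.isConsistent_diag_horizontal hsat hκ hNTP hdiag N)
  obtain ⟨b, hb⟩ := hcol (Finset.range N)
  simp only [realize_tupleFormula, Finset.mem_range, mul_zero, zero_add] at hb
  exact ⟨b, fun p hp => hb p.1 (hN p hp).1 ⟨p.2, (hN p hp).2⟩⟩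

end Arrays

/-! ### Transfer of `TP₂` to `M` and extraction of indiscernible arrays. -/

section Extraction

variable {L : FirstOrder.Language.{u, v}} {M : Type w} [L.Structure M] [Nonempty M]
  {κ : Cardinal.{w}}

/-- `TP₂` is witnessed in every saturated model of a complete theory. -/
theorem HasTP2.transfer {T : L.Theory} (hT : T.IsComplete) (hM : M ⊨ T)
    (hsat : IsSaturated L M κ) (hκ : ℵ₀ < κ) {N : Type*} [L.Structure N] [Nonempty N]
    (hN : N ⊨ T) {n m : ℕ} {φ : L.Formula (Fin n ⊕ Fin m)} (h : HasTP2 N φ) : HasTP2 M φ := by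
  classical
  obtain ⟨a, k, hk, hf⟩ := h
  let em : ((∅ : Set M) ⊕ (ℕ × ℕ × Fin m)) → ℕ × ℕ × Fin m :=
    Sum.elim (fun x => x.2.elim) id
  have hem : ∀ v : ℕ × ℕ × Fin m → M, v ∘ em = Sum.elim Subtype.val v := by
    intro v
    ext (x | p)
    · exact x.2.elim
    · rfl
  obtain ⟨d, hd⟩ := exists_realize_countable hsat hκ (mk_empty_lt hκ)
    (p := {ψ : L.Formula ((∅ : Set M) ⊕ (ℕ × ℕ × Fin m)) |
      (ψ.relabel em).Realize fun p => a p.1 p.2.1 p.2.2}) (by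
    intro q hq
    obtain ⟨v, hv⟩ := exists_realize_of_complete hT hM hN ((conj q).relabel em)
      ⟨fun p => a p.1 p.2.1 p.2.2, by
        rw [Formula.realize_relabel, realize_conj]
        intro ψ hψ
        rw [← Formula.realize_relabel]
        exact hq hψ⟩
    rw [Formula.realize_relabel, realize_conj, hem] at hv
    exact ⟨v, hv⟩)
  have hd' : ∀ ψ : L.Formula (ℕ × ℕ × Fin m), (ψ.Realize fun p => a p.1 p.2.1 p.2.2) →
      ψ.Realize d := by
    intro ψ hψ
    have := hd (ψ.relabel Sum.inr) (by
      simp only [Set.mem_ofPred_eq, Formula.realize_relabel]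
      exact hψ)
    rwa [Formula.realize_relabel] at this
  refine ⟨fun i j l => d (i, j, l), k, fun i s hs hb => ?_, fun f s => ?_⟩
  · refine (hd' (familyFormula φ s fun j l => (i, j, l)).not ?_) ?_
    · exact fun H => hk i s hs ((realize_familyFormula _ _ _ _).1 H)
    · exact (realize_familyFormula _ _ _ _).2 hb
  · exact (realize_familyFormula _ _ _ _).1 (hd' (familyFormula φ s fun i l => (i, f i, l))
      ((realize_familyFormula _ _ _ _).2 (hf f s)))

/-- An array has an indiscernible array satisfying each formula true of all its subarrays obtained
by strictly increasing changes of rows and columns. -/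
theorem exists_isIndiscernibleArray (hsat : IsSaturated L M κ) (hκ : ℵ₀ < κ) {m : ℕ}
    (a : ℕ → ℕ → Fin m → M) :
    ∃ a' : ℕ → ℕ → Fin m → M, IsIndiscernibleArray L ∅ a' ∧
      ∀ ψ : L.Formula (ℕ × ℕ × Fin m),
        (∀ s t : ℕ → ℕ, StrictMono s → StrictMono t →
          ψ.Realize fun p => a (s p.1) (t p.2.1) p.2.2) →
        ψ.Realize fun p => a' p.1 p.2.1 p.2.2 := by
  obtain ⟨c, hc, hac⟩ := exists_isIndiscernible (L := L) hsat hκ (mk_empty_lt hκ)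
    (fun j (p : ℕ × Fin m) => a p.1 j p.2)
  obtain ⟨d, hd, hcd⟩ := exists_isIndiscernible (L := L) hsat hκ (mk_empty_lt hκ)
    (fun i (p : ℕ × Fin m) => c p.1 (i, p.2))
  refine ⟨fun i j l => d i (j, l), ⟨hd, isIndiscernible_iff.2 fun t ht ψ => ?_⟩, fun ψ hψ => ?_⟩
  · let e : (ℕ → ℕ) → (∅ : Set M) ⊕ (ℕ × ℕ × Fin m) → (∅ : Set M) ⊕ (ℕ × ℕ × Fin m) :=
      fun t => Sum.map id fun p => (p.2.1, t p.1, p.2.2)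
    have he : ∀ (t : ℕ → ℕ) (v : ℕ × ℕ × Fin m → M),
        Sum.elim (Subtype.val : (∅ : Set M) → M) v ∘ e t =
          Sum.elim Subtype.val fun p => v (p.2.1, t p.1, p.2.2) := by
      intro t v
      ext (x | p) <;> rfl
    -- Column indiscernibility of `c` amounts to biconditionals true of every subsequence of its
    -- rows, so it survives the second extraction.
    have := hcd ((ψ.relabel (e id)).iff (ψ.relabel (e t))) (fun s hs => by
      simp only [Formula.realize_iff, Formula.realize_relabel, he]
      exact (isIndiscernible_iff.1 hc t ht).comp
        (fun p : ℕ × ℕ × Fin m => (p.1, s p.2.1, p.2.2)) ψ) id strictMono_id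
    simpa only [Formula.realize_iff, Formula.realize_relabel, he, id] using this
  · have := hcd (ψ.relabel Sum.inr) (fun s hs => ?_) id strictMono_id
    · rwa [Formula.realize_relabel] at this
    rw [Formula.realize_relabel]
    have := hac (ψ.relabel fun p => Sum.inr (p.2.1, s p.1, p.2.2)) (fun t ht => by
      rw [Formula.realize_relabel]
      exact hψ s t hs ht) id strictMono_id
    rwa [Formula.realize_relabel] at this

theorem HasTP2.exists_isIndiscernibleArray (hsat : IsSaturated L M κ) (hκ : ℵ₀ < κ) {n m : ℕ}
    {φ : L.Formula (Fin n ⊕ Fin m)} (h : HasTP2 M φ) :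
    ∃ a : ℕ → ℕ → Fin m → M, IsIndiscernibleArray L ∅ a ∧ IsConsistent φ (fun i => a i i) ∧
      ¬ IsConsistent φ fun p : ℕ × ℕ => a p.1 p.2 := by
  obtain ⟨a, k, hk, hf⟩ := h
  obtain ⟨a', ha', h⟩ := NTP2.exists_isIndiscernibleArray (L := L) hsat hκ a
  refine ⟨a', ha', fun S => ?_, fun hcons => ?_⟩
  · refine (realize_familyFormula _ _ _ _).1 (h (familyFormula φ S fun i l => (i, i, l))
      fun s t hs ht => (realize_familyFormula _ _ _ _).2 ?_)
    -- This path goes through column `t i` in row `s i`; `invFun` recovers `i` from `s i`.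
    obtain ⟨b, hb⟩ := hf (fun i => t (Function.invFun s i)) (S.image s)
    refine ⟨b, fun i hi => ?_⟩
    have := hb (s i) (Finset.mem_image_of_mem _ hi)
    dsimp only at this
    rwa [Function.leftInverse_invFun hs.injective i] at this
  · obtain ⟨b, hb⟩ := hcons ((Finset.range k).image fun j => (0, j))
    refine h (familyFormula φ (Finset.range k) fun j l => (0, j, l)).not
      (fun s t hs ht => Formula.realize_not.2 fun H => ?_)
      ((realize_familyFormula _ _ _ _).2 ⟨b, fun j hj => hb (0, j) (Finset.mem_image_of_mem _ hj)⟩)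
    obtain ⟨b, hb⟩ := (realize_familyFormula _ _ _ _).1 H
    refine hk (s 0) ((Finset.range k).image t) ?_ ⟨b, fun j hj => ?_⟩
    · rw [Finset.card_image_of_injective _ ht.injective, Finset.card_range]
    · obtain ⟨i, hi, rfl⟩ := Finset.mem_image.1 hj
      exact hb i hi

end Extraction

/-! ### Dividing and array-dividing. -/

section Dividing

variable {L : FirstOrder.Language.{u, v}} {M : Type w} [L.Structure M] [Nonempty M]
  {κ : Cardinal.{w}}

/-- A finite tuple of the same type as the first term of a countable sequence is itself the first
term of a sequence of the same type. -/
theorem SameType.exists_extend (hsat : IsSaturated L M κ) (hκ : ℵ₀ < κ) {A : Set M}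
    (hA : #A < κ) {m : ℕ} {c : ℕ → Fin m → M} {a : Fin m → M} (h : SameType L A (c 0) a) :
    ∃ c' : ℕ → Fin m → M, c' 0 = a ∧
      SameType L A (fun p : ℕ × Fin m => c p.1 p.2) (fun p => c' p.1 p.2) := by
  classical
  let B : Set M := A ∪ Set.range a
  have hB : #B < κ := (mk_union_le _ _).trans_lt
    (add_lt_of_lt hκ.le hA ((Set.finite_range a).lt_aleph0.trans hκ))
  let e : A ⊕ (ℕ × Fin m) → B ⊕ (ℕ × Fin m) :=
    Sum.elim (fun x => Sum.inl ⟨x, Or.inl x.2⟩)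
      fun p => if p.1 = 0 then Sum.inl ⟨a p.2, Or.inr ⟨_, rfl⟩⟩ else Sum.inr p
  let e' : A ⊕ (ℕ × Fin m) → (A ⊕ Fin m) ⊕ (ℕ × Fin m) :=
    Sum.elim (fun x => Sum.inl (Sum.inl x))
      fun p => if p.1 = 0 then Sum.inl (Sum.inr p.2) else Sum.inr p
  have he : ∀ v : ℕ × Fin m → M, Sum.elim (Subtype.val : B → M) v ∘ e =
      Sum.elim Subtype.val fun p => if p.1 = 0 then a p.2 else v p := by
    intro v
    ext (x | p)
    · rfl
    · simp only [Function.comp, e, Sum.elim_inr]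
      split_ifs <;> rfl
  have he' : ∀ (a : Fin m → M) (v : ℕ × Fin m → M),
      Sum.elim (Sum.elim (Subtype.val : A → M) a) v ∘ e' =
        Sum.elim Subtype.val fun p => if p.1 = 0 then a p.2 else v p := by
    intro a v
    ext (x | p)
    · rfl
    · simp only [Function.comp, e', Sum.elim_inr]
      split_ifs <;> rfl
  obtain ⟨w, hw⟩ := exists_realize_countable hsat hκ hB
    (p := (fun ψ : L.Formula (A ⊕ (ℕ × Fin m)) => ψ.relabel e) ''
      {ψ | ψ.Realize (Sum.elim Subtype.val fun p : ℕ × Fin m => c p.1 p.2)}) (by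
    intro q hq
    obtain ⟨q', hq', rfl⟩ := Finset.subset_set_image_iff.1 hq
    -- The remaining terms are quantified away, leaving a formula true of `c 0` and hence of `a`.
    obtain ⟨w, hw⟩ := (realize_exProj _ _).1 ((h (exProj ((conj q').relabel e'))).1
      ((realize_exProj _ _).2 ⟨fun p => c p.1 p.2, by
        rw [Formula.realize_relabel, he', realize_conj]
        intro ψ hψ
        have h0 : (fun p : ℕ × Fin m => if p.1 = 0 then c 0 p.2 else c p.1 p.2) =
            fun p => c p.1 p.2 := by
          ext p
          split_ifs with h0
          · rw [h0]
          · rfl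
        rw [h0]
        exact hq' hψ⟩))
    rw [Formula.realize_relabel, he', realize_conj] at hw
    refine ⟨w, ?_⟩
    rw [Finset.forall_mem_image]
    intro ψ hψ
    rw [Formula.realize_relabel, he]
    exact hw ψ hψ)
  refine ⟨fun i l => if i = 0 then a l else w (i, l), by simp, fun ψ => ?_⟩
  have key : ∀ ψ : L.Formula (A ⊕ (ℕ × Fin m)),
      ψ.Realize (Sum.elim Subtype.val fun p : ℕ × Fin m => c p.1 p.2) →
      ψ.Realize (Sum.elim Subtype.val fun p : ℕ × Fin m => if p.1 = 0 then a p.2 else w p) := by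
    intro ψ hψ
    have := hw _ ⟨ψ, hψ, rfl⟩
    rwa [Formula.realize_relabel, he] at this
  refine ⟨key ψ, fun hψ => ?_⟩
  by_contra hn
  exact key ψ.not hn hψ

theorem Divides.exists_isIndiscernible (hsat : IsSaturated L M κ) (hκ : ℵ₀ < κ) {A : Set M}
    (hA : #A < κ) {n m : ℕ} {φ : L.Formula (Fin n ⊕ Fin m)} {a : Fin m → M}
    (h : Divides φ a A) :
    ∃ c : ℕ → Fin m → M, c 0 = a ∧ IsIndiscernible L A c ∧ ¬ IsConsistent φ c := by
  obtain ⟨k, b, hb, hk⟩ := h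
  obtain ⟨d, hd, hbd⟩ := NTP2.exists_isIndiscernible (L := L) hsat hκ hA b
  have hda : SameType L A (d 0) a := by
    have key : ∀ ψ : L.Formula (A ⊕ Fin m), ψ.Realize (Sum.elim Subtype.val a) →
        ψ.Realize (Sum.elim Subtype.val (d 0)) := by
      intro ψ hψ
      have hcomp : ∀ v : ℕ × Fin m → M,
          Sum.elim (Subtype.val : A → M) v ∘ Sum.map id (fun l => (0, l)) =
            Sum.elim Subtype.val fun l => v (0, l) := fun v => by ext (x | p) <;> rfl
      have := hbd (ψ.relabel (Sum.map id fun l => (0, l))) (fun s _ => by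
        rw [Formula.realize_relabel, hcomp]
        exact (hb (s 0) ψ).2 hψ) id strictMono_id
      rwa [Formula.realize_relabel, hcomp] at this
    refine fun ψ => ⟨fun hψ => ?_, key ψ⟩
    by_contra hn
    exact key ψ.not hn hψ
  have hdk : ¬ ∃ x : Fin n → M, ∀ i ∈ Finset.range k, φ.Realize (Sum.elim x (d i)) := by
    have := hbd ((familyFormula φ (Finset.range k) fun i l => (i, l)).relabel Sum.inr).not
      (fun s hs => ?_) id strictMono_id
    · rw [Formula.realize_not, Formula.realize_relabel] at this
      exact fun H => this ((realize_familyFormula _ _ _ _).2 H)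
    · rw [Formula.realize_not, Formula.realize_relabel]
      intro H
      obtain ⟨x, hx⟩ := (realize_familyFormula _ _ _ _).1 H
      refine hk ((Finset.range k).image s) ?_ ⟨x, ?_⟩
      · rw [Finset.card_image_of_injective _ hs.injective, Finset.card_range]
      · rw [Finset.forall_mem_image]
        exact hx
  obtain ⟨c, hc0, hc⟩ := hda.exists_extend hsat hκ hA
  refine ⟨c, hc0, fun r s t hs ht => ?_, fun H => hdk ?_⟩
  · exact (hc.symm.comp fun p : Fin r × Fin m => (s p.1, p.2)).trans
      ((hd r s t hs ht).trans (hc.comp fun p : Fin r × Fin m => (t p.1, p.2)))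
  · have := hc.realize_iff (familyFormula φ (Finset.range k) fun i l => (i, l))
    rw [realize_familyFormula, realize_familyFormula] at this
    exact this.2 (H _)

theorem Divides.arrayDivides (hsat : IsSaturated L M κ) (hκ : ℵ₀ < κ) {A : Set M}
    (hA : #A < κ) {n m : ℕ} {φ : L.Formula (Fin n ⊕ Fin m)} {a : Fin m → M}
    (h : Divides φ a A) : ArrayDivides φ a A := by
  obtain ⟨c, hc0, hc, hcons⟩ := h.exists_isIndiscernible hsat hκ hA
  refine ⟨fun i _ => c i, ⟨fun r s t hs ht => ?_, fun r s t _ _ _ => Iff.rfl⟩, hc0, fun H =>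
    hcons fun S => ?_⟩
  · exact (hc r s t hs ht).comp fun p : Fin r × ℕ × Fin m => (p.1, p.2.2)
  · obtain ⟨b, hb⟩ := H (S.image fun i => (i, 0))
    exact ⟨b, fun i hi => hb (i, 0) (Finset.mem_image_of_mem _ hi)⟩

/-- The diagonal must be inconsistent, since the whole array is. Invariance makes satisfiability of
a finite part of it depend on size alone, so one unsatisfiable part gives `k`-inconsistency with `k`
its size. -/
theorem ArrayDivides.divides (hsat : IsSaturated L M κ) (hκ : ℵ₀ < κ) {A : Set M}
    {n m : ℕ} {φ : L.Formula (Fin n ⊕ Fin m)} {a : Fin m → M}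
    (hNTP : ∀ (m : ℕ) (φ : L.Formula (Fin n ⊕ Fin m)), ¬ HasTP2 M φ)
    (h : ArrayDivides φ a A) : Divides φ a A := by
  obtain ⟨b, hb, rfl, hcons⟩ := h
  have hdiag : ¬ IsConsistent φ fun i => b i i :=
    mt ((hb.gridInvariant φ).isConsistent hsat hκ hNTP) hcons
  obtain ⟨S, hS⟩ : ∃ S : Finset ℕ,
      ¬ ∃ x : Fin n → M, ∀ i ∈ S, φ.Realize (Sum.elim x (b i i)) := by
    simpa only [IsConsistent, not_forall] using hdiag
  have hcard : ∀ T : Finset ℕ, (∃ x : Fin n → M, ∀ i ∈ T, φ.Realize (Sum.elim x (b i i))) ↔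
      ∃ x : Fin n → M, ∀ i ∈ Finset.range T.card, φ.Realize (Sum.elim x (b i i)) := by
    intro T
    obtain ⟨t, ht, hT⟩ := exists_strictMono_image T
    have := hb.gridInvariant φ t t ht ht ((Finset.range T.card).image fun i => (i, i))
    simp only [Finset.forall_mem_image] at this
    rw [this]
    nth_rw 1 [← hT]
    simp only [Finset.forall_mem_image]
  refine ⟨S.card, fun i => b i i, fun i => ?_, fun T hT H => hS ?_⟩
  · have hi : StrictMono fun x => x + i := fun x y hxy => by simpa using hxy
    simpa [Function.comp_def] using (hb.sameType hi hi).symm.comp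
      (fun l : Fin m => ((0, 0, l) : ℕ × ℕ × Fin m))
  · rw [hcard, ← hT, ← hcard]
    exact H

end Dividing

end NTP2


theorem mainTheorem3 {L : FirstOrder.Language.{u, v}} (T : L.Theory)
    (hT : T.IsComplete) (M : Type w) [L.Structure M] [Nonempty M] (hM : M ⊨ T)
    (κ : Cardinal.{w}) (hκ : ℵ₀ < κ) (hsat : NTP2.IsSaturated L M κ) :
    (NTP2.IsNTP2.{u, v, w} T ↔
      ∀ (n m : ℕ) (φ : L.Formula (Fin n ⊕ Fin m)) (a : ℕ → ℕ → Fin m → M),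
        NTP2.IsIndiscernibleArray L ∅ a →
        NTP2.IsConsistent φ (fun i => a i i) →
        NTP2.IsConsistent φ (fun p : ℕ × ℕ => a p.1 p.2)) ∧
    (NTP2.IsNTP2.{u, v, w} T →
      ∀ (n m : ℕ) (φ : L.Formula (Fin n ⊕ Fin m)) (a : Fin m → M) (A : Set M), #A < κ →
        (NTP2.Divides φ a A ↔ NTP2.ArrayDivides φ a A)) := by
  have hNTP : NTP2.IsNTP2.{u, v, w} T →
      ∀ (n m : ℕ) (φ : L.Formula (Fin n ⊕ Fin m)), ¬ NTP2.HasTP2 M φ := fun h =>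
    h (FirstOrder.Language.Theory.ModelType.of T M)
  refine ⟨⟨fun h n m φ a ha hdiag => ?_, fun h N n m φ hφ => ?_⟩, fun h n m φ a A hA => ?_⟩
  · exact (ha.gridInvariant φ).isConsistent hsat hκ (hNTP h n) hdiag
  · obtain ⟨a, ha, hdiag, hcons⟩ :=
      (hφ.transfer hT hM hsat hκ N.is_model).exists_isIndiscernibleArray hsat hκ
    exact hcons (h n m φ a ha hdiag)
  · exact ⟨fun H => H.arrayDivides hsat hκ hA, fun H => H.divides hsat hκ (hNTP h n)⟩
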